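/- Let $G$ be a Hausdorff para-topological group, that is, a group with a Hausdorff topology for which multiplication $G\times G\to G$ is jointly continuous (inversion need not be continuous). Suppose that $G$ is compactly generated: there is a compact set $\Gamma\subseteq G$ with $e\in\Gamma=\Gamma^{-1}$ and $G=\bigcup_{r\ge 1}\Gamma^r$. Let $G$ act on a non-empty compact Hausdorff space $X$ by a jointly continuous action $G\times X\to X$, and suppose that $X$ is not connected and that the flow $(G,X)$ is distal, i.e. for all $x\neq y$ in $X$ the closure of $\{(gx,gy):g\in G\}$ in $X\times X$ does not meet the diagonal. Then $(G,X)$ has an equicontinuous non-trivial factor $(G,Y)$, and one can take for $Y$ the quotient of $X$ by the relation of lying in the same connected component. More precisely, $Y$ with the quotient topology is a compact Hausdorff space with more than one point, and there is a jointly continuous action of $G$ on $Y$ for which the canonical map $\rho\colon X\to Y$ is a continuous $G$-equivariant surjection, and which is equicontinuous: for every $y\in Y$ and every entourage $\varepsilon$ of the unique uniformity of $Y$ compatible with its topology, there is a neighborhood $U$ of $y$ with $(gy,gz)\in\varepsilon$ for all $g\in G$ and all $z\in U$. -/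

import Mathlib

open scoped Pointwise

/-- A group with a topology is compactly generated if it is the union of the powers `Γ ^ r`, `r ≥ 1`,
of a compact symmetric set `Γ` that contains the identity. -/
def IsCompactlyGeneratedGroup (G : Type*) [Group G] [TopologicalSpace G] : Prop :=
  ∃ Γ : Set G, IsCompact Γ ∧ (1 : G) ∈ Γ ∧ Γ⁻¹ = Γ ∧ (⋃ r ∈ Set.Ici (1 : ℕ), Γ ^ r) = Set.univ

/-- The action of `G` on `X` is distal if for `x ≠ y` the closure in `X × X` of the orbit of `(x, y)`
under the diagonal action does not meet the diagonal. -/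
def IsDistalFlow (G X : Type*) [Group G] [TopologicalSpace X] [MulAction G X] : Prop :=
  ∀ x y : X, x ≠ y → Set.diagonal X ∩ closure (MulAction.orbit G ((x, y) : X × X)) = ∅

/-- The action of `G` on a compact Hausdorff space `Y` is equicontinuous if the family of the
translations `y ↦ g • y` is equicontinuous at every point, for the unique uniformity of `Y` that
induces its topology. -/
def IsEquicontinuousFlow (G Y : Type*) [Group G] [TopologicalSpace Y] [CompactSpace Y] [T2Space Y]
    [MulAction G Y] : Prop :=
  letI : UniformSpace Y := uniformSpaceOfCompactR1
  Equicontinuous (fun (g : G) (y : Y) => g • y)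

/-- `π` is a factor map (an extension) from the flow on `X` to the flow on `Y`: a continuous
equivariant surjection. -/
structure IsFactorMap (G : Type*) {X Y : Type*} [Group G] [TopologicalSpace X] [TopologicalSpace Y]
    [MulAction G X] [MulAction G Y] (π : X → Y) : Prop where
  continuous : Continuous π
  surjective : Function.Surjective π
  map_smul : ∀ (g : G) (x : X), π (g • x) = g • π x

open Set Topology Filter

/-! Distality makes orbit closures in `X × X` minimal, by an idempotent of the enveloping semigroup
(`IsDistalFlow.mem_closure_orbit_symm`), and minimality descends to the square of the component
space `Y`. As `Y` is totally disconnected, the diagonal of `Y × Y` has a base of clopen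
neighbourhoods `C`, so equicontinuity means that pairs near the diagonal never leave `C`. If some
did (`eventually_forall_smul_mem_of_isClopen`), the points from which they exit would accumulate at
a point `u` that leaves `C` under `Γ`, while its orbit closure contains a `t` with orbit inside `C`.
Minimality puts `u` in the orbit closure of `t`, a contradiction. -/

/-! ### Minimal orbit closures from distality -/

theorem smul_mem_closure_orbit {G W : Type*} [Group G] [TopologicalSpace W] [MulAction G W]
    [ContinuousConstSMul G W] (g : G) {w v : W} (hv : v ∈ closure (MulAction.orbit G w)) :
    g • v ∈ closure (MulAction.orbit G w) := by
  refine map_mem_closure (continuous_const_smul g) hv ?_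
  rintro _ ⟨h, rfl⟩
  exact ⟨g * h, mul_smul g h w⟩

theorem closure_orbit_subset {G W : Type*} [Group G] [TopologicalSpace W] [MulAction G W]
    {w : W} {C : Set W} (hC : IsClosed C) (h : ∀ g : G, g • w ∈ C) :
    closure (MulAction.orbit G w) ⊆ C :=
  closure_minimal (by rintro _ ⟨g, rfl⟩; exact h g) hC

/-- Closed conditions on translations pass to their pointwise limits, the elements of the enveloping
semigroup. -/
theorem mem_closure_range_apply {G W : Type*} [Group G] [TopologicalSpace W] [MulAction G W]
    {p : W → W} (hp : p ∈ closure (range fun (g : G) (w : W) => g • w)) {Z : Type*}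
    [TopologicalSpace Z] {f : (W → W) → Z} (hf : Continuous f) {C : Set Z} (hC : IsClosed C)
    (h : ∀ g : G, f (fun w => g • w) ∈ C) : f p ∈ C :=
  closure_minimal (s := range fun (g : G) (w : W) => g • w) (t := f ⁻¹' C)
    (by rintro _ ⟨g, rfl⟩; exact h g) (hC.preimage hf) hp

/-- In a distal flow on a compact Hausdorff space the orbit closures are minimal. -/
theorem IsDistalFlow.mem_closure_orbit_symm {G W : Type*} [Group G] [TopologicalSpace W]
    [CompactSpace W] [T2Space W] [MulAction G W] [ContinuousConstSMul G W]
    (hW : IsDistalFlow G W) {w v : W} (hv : v ∈ closure (MulAction.orbit G w)) :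
    w ∈ closure (MulAction.orbit G v) := by
  set E : Set (W → W) := closure (range fun (g : G) (w : W) => g • w) with hE
  set M := closure (MulAction.orbit G v) with hM
  let _ : Semigroup (W → W) := { mul := fun p q => p ∘ q, mul_assoc := fun _ _ _ => rfl }
  have hmul : ∀ p q : W → W, p * q = p ∘ q := fun _ _ => rfl
  have hcont : ∀ r : W → W, Continuous (· * r) := fun r =>
    continuous_pi fun x => continuous_apply (r x)
  have hEclosed : IsClosed E := isClosed_closure
  have hmem : ∀ g : G, (fun w : W => g • w) ∈ E := fun g => subset_closure ⟨g, rfl⟩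
  -- Composition is continuous in `q` only when the left factor is continuous, so `p` is first
  -- reduced to a translation.
  have hEmul : ∀ p ∈ E, ∀ q ∈ E, p * q ∈ E := by
    intro p hp q hq
    refine mem_closure_range_apply (G := G) hp (hcont q) hEclosed fun g => ?_
    have hc : Continuous fun q : W → W => (fun w : W => g • w) ∘ q :=
      continuous_pi fun x => (continuous_apply x).const_smul g
    refine mem_closure_range_apply (G := G) hq hc hEclosed fun h => ?_
    have : (fun w : W => g • w) ∘ (fun w : W => h • w) = fun w : W => (g * h) • w :=
      funext fun x => (mul_smul g h x).symm
    rw [this]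
    exact hmem _
  have hEv : ∃ p ∈ E, p w = v := by
    have hcl : IsClosed ((fun p : W → W => p w) '' E) :=
      (hEclosed.isCompact.image (continuous_apply w)).isClosed
    exact closure_orbit_subset hcl (fun g : G => ⟨_, hmem g, rfl⟩) hv
  obtain ⟨u, ⟨huE, huM⟩, hu⟩ := exists_idempotent_in_compact_subsemigroup hcont
    (E ∩ {p | p w ∈ M})
    (by
      obtain ⟨p, hp, hpv⟩ := hEv
      refine ⟨p, hp, ?_⟩
      rw [mem_ofPred_eq, hpv]
      exact subset_closure (MulAction.mem_orbit_self v))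
    (hEclosed.inter (isClosed_closure.preimage (continuous_apply w))).isCompact
    (by
      rintro p ⟨hp, _⟩ q ⟨hq, hqM⟩
      exact ⟨hEmul p hp q hq, mem_closure_range_apply (G := G) (f := fun p : W → W => p (q w)) hp
        (continuous_apply (q w)) isClosed_closure fun g => smul_mem_closure_orbit g hqM⟩)
  have huu : u (u w) = u w := congrFun hu w
  have hwu : w = u w := by
    by_contra hne
    -- The idempotent `u` sends `w` and `u w` to the same point, which distality forbids unless they
    -- are equal.
    have h2 : (u w, u (u w)) ∈ closure (MulAction.orbit G ((w, u w) : W × W)) :=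
      mem_closure_range_apply (G := G) (f := fun p : W → W => (p w, p (u w))) huE
        ((continuous_apply w).prodMk (continuous_apply (u w))) isClosed_closure
        fun g => subset_closure ⟨g, rfl⟩
    have : (u w, u (u w)) ∈ (∅ : Set (W × W)) := hW w (u w) hne ▸ ⟨huu.symm, h2⟩
    exact this
  rw [hwu]
  exact huM

theorem IsDistalFlow.prod {G X Y : Type*} [Group G] [TopologicalSpace X] [MulAction G X]
    [TopologicalSpace Y] [MulAction G Y] (hX : IsDistalFlow G X) (hY : IsDistalFlow G Y) :
    IsDistalFlow G (X × Y) := by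
  rintro ⟨x, y⟩ ⟨x', y'⟩ hne
  rw [eq_empty_iff_forall_notMem]
  rintro ⟨a, b⟩ ⟨hab, hcl⟩
  obtain rfl : a = b := hab
  have h1 : (a.1, a.1) ∈ closure (MulAction.orbit G ((x, x') : X × X)) := by
    refine map_mem_closure (f := fun p : (X × Y) × (X × Y) => (p.1.1, p.2.1))
      (by fun_prop) hcl ?_
    rintro _ ⟨g, rfl⟩
    exact ⟨g, rfl⟩
  have h2 : (a.2, a.2) ∈ closure (MulAction.orbit G ((y, y') : Y × Y)) := by
    refine map_mem_closure (f := fun p : (X × Y) × (X × Y) => (p.1.2, p.2.2))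
      (by fun_prop) hcl ?_
    rintro _ ⟨g, rfl⟩
    exact ⟨g, rfl⟩
  have hx : x = x' := by
    by_contra h
    exact eq_empty_iff_forall_notMem.1 (hX x x' h) _ ⟨rfl, h1⟩
  have hy : y = y' := by
    by_contra h
    exact eq_empty_iff_forall_notMem.1 (hY y y' h) _ ⟨rfl, h2⟩
  exact hne (by rw [hx, hy])

/-- Minimality of the orbit closures passes to factors of compact flows. -/
theorem IsFactorMap.mem_closure_orbit_symm {G W Z : Type*} [Group G] [TopologicalSpace W]
    [CompactSpace W] [MulAction G W] [TopologicalSpace Z] [T2Space Z] [MulAction G Z] {π : W → Z}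
    (hπ : IsFactorMap G π)
    (hW : ∀ w v : W, v ∈ closure (MulAction.orbit G w) → w ∈ closure (MulAction.orbit G v))
    {z t : Z} (ht : t ∈ closure (MulAction.orbit G z)) :
    z ∈ closure (MulAction.orbit G t) := by
  obtain ⟨w, rfl⟩ := hπ.surjective z
  have hcl : IsClosed (π '' closure (MulAction.orbit G w)) :=
    (isClosed_closure.isCompact.image hπ.continuous).isClosed
  obtain ⟨v, hv, rfl⟩ := closure_orbit_subset hcl
    (fun g : G => ⟨g • w, subset_closure ⟨g, rfl⟩, hπ.map_smul g w⟩) ht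
  refine map_mem_closure hπ.continuous (hW w v hv) ?_
  rintro _ ⟨g, rfl⟩
  exact ⟨g, (hπ.map_smul g v).symm⟩

theorem IsFactorMap.prodMap {G X X' Y Y' : Type*} [Group G] [TopologicalSpace X]
    [TopologicalSpace X'] [TopologicalSpace Y] [TopologicalSpace Y'] [MulAction G X]
    [MulAction G X'] [MulAction G Y] [MulAction G Y'] {π : X → Y} {π' : X' → Y'}
    (hπ : IsFactorMap G π) (hπ' : IsFactorMap G π') : IsFactorMap G (Prod.map π π') where
  continuous := hπ.continuous.prodMap hπ'.continuous
  surjective := hπ.surjective.prodMap hπ'.surjective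
  map_smul g x := Prod.ext (hπ.map_smul g x.1) (hπ'.map_smul g x.2)

/-! ### Orbits staying in a clopen set -/

theorem IsCompact.isClosed_setOf_exists_smul_mem {G W : Type*} [TopologicalSpace G]
    [TopologicalSpace W] [CompactSpace W] [T2Space W] [SMul G W] [ContinuousSMul G W]
    {K : Set G} (hK : IsCompact K) {F : Set W} (hF : IsClosed F) :
    IsClosed {w : W | ∃ g ∈ K, g • w ∈ F} := by
  have h : IsCompact ((K ×ˢ univ) ∩ (fun p : G × W => p.1 • p.2) ⁻¹' F) :=
    (hK.prod isCompact_univ).inter_right (hF.preimage continuous_smul)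
  convert (h.image continuous_snd).isClosed using 1
  ext w
  constructor
  · rintro ⟨g, hg, hw⟩
    exact ⟨(g, w), ⟨⟨hg, mem_univ _⟩, hw⟩, rfl⟩
  · rintro ⟨⟨g, w⟩, ⟨⟨hg, -⟩, hw⟩, rfl⟩
    exact ⟨g, hg, hw⟩

theorem IsCompact.isOpen_setOf_forall_smul_mem {G W : Type*} [TopologicalSpace G]
    [TopologicalSpace W] [CompactSpace W] [T2Space W] [SMul G W] [ContinuousSMul G W]
    {K : Set G} (hK : IsCompact K) {U : Set W} (hU : IsOpen U) :
    IsOpen {w : W | ∀ g ∈ K, g • w ∈ U} := by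
  rw [← isClosed_compl_iff]
  convert hK.isClosed_setOf_exists_smul_mem hU.isClosed_compl using 1
  ext w
  simp

theorem isClosed_setOf_forall_smul_mem {G W : Type*} [TopologicalSpace W] [SMul G W]
    [ContinuousConstSMul G W] (K : Set G) {F : Set W} (hF : IsClosed F) :
    IsClosed {w : W | ∀ g ∈ K, g • w ∈ F} := by
  simp only [ofPred_forall]
  exact isClosed_biInter fun g _ => hF.preimage (continuous_const_smul g)

theorem IsCompact.pow_set {G : Type*} [Monoid G] [TopologicalSpace G] [ContinuousMul G]
    {K : Set G} (hK : IsCompact K) (n : ℕ) : IsCompact (K ^ n) := by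
  induction n with
  | zero => rw [pow_zero]; exact isCompact_singleton
  | succ n ih => rw [pow_succ]; exact ih.mul hK

/-- If a compactly generated group acts with minimal orbit closures, then a point whose orbit stays
in a clopen set `C` has a neighbourhood whose orbit stays in `C`. -/
theorem eventually_forall_smul_mem_of_isClopen {G W : Type*} [Group G] [TopologicalSpace G]
    [ContinuousMul G] (hG : IsCompactlyGeneratedGroup G) [TopologicalSpace W] [CompactSpace W]
    [T2Space W] [MulAction G W] [ContinuousSMul G W]
    (hW : ∀ w v : W, v ∈ closure (MulAction.orbit G w) → w ∈ closure (MulAction.orbit G v))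
    {C : Set W} (hC : IsClopen C) {w : W} (hw : ∀ g : G, g • w ∈ C) :
    ∀ᶠ v in 𝓝 w, ∀ g : G, g • v ∈ C := by
  obtain ⟨Γ, hΓ, h1, hinv, hgen⟩ := hG
  have hgen' : ∀ g : G, ∃ n, g ∈ Γ ^ n := fun g => by
    have hg : g ∈ ⋃ r ∈ Ici (1 : ℕ), Γ ^ r := hgen ▸ mem_univ g
    simp only [mem_iUnion] at hg
    obtain ⟨n, -, hn⟩ := hg
    exact ⟨n, hn⟩
  have hmono : Monotone fun n : ℕ => Γ ^ n := fun m n h => pow_right_monotone (by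
    rw [← singleton_one]; simpa using h1) h
  set D : ℕ → Set W := fun n => {v | ∀ g ∈ Γ ^ n, g • v ∈ C} with hD
  have hDanti : Antitone D := fun m n h v hv g hg => hv g (hmono h hg)
  have hDopen : ∀ n, IsOpen (D n) := fun n =>
    (hΓ.pow_set n).isOpen_setOf_forall_smul_mem hC.isOpen
  have hDclosed : ∀ n, IsClosed (D n) := fun n => isClosed_setOf_forall_smul_mem _ hC.isClosed
  set A : ℕ → Set W := fun k => {v | ∃ g ∈ Γ ^ k, g • v ∈ D k} with hA
  have hAclosed : ∀ k, IsClosed (A k) := fun k =>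
    (hΓ.pow_set k).isClosed_setOf_exists_smul_mem (hDclosed k)
  set B : Set W := {v | ∃ g ∈ Γ, g • v ∈ Cᶜ} with hB
  have hBclosed : IsClosed B := hΓ.isClosed_setOf_exists_smul_mem hC.compl.isClosed
  by_contra hcon
  -- Exit points: the orbit has stayed in `C` for a long time and is about to leave it.
  have hexit : ∀ n : ℕ, (B ∩ ⋂ k ∈ Iic n, A k).Nonempty := by
    intro n
    obtain ⟨v, hvn, hv⟩ : ∃ v ∈ D n, ¬ ∀ g : G, g • v ∈ C := by
      by_contra! h
      exact hcon (mem_of_superset ((hDopen n).mem_nhds fun g _ => hw g) h)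
    have hex : ∃ m, v ∉ D m := by
      push Not at hv
      obtain ⟨g, hg⟩ := hv
      obtain ⟨m, hm⟩ := hgen' g
      exact ⟨m, fun h => hg (h g hm)⟩
    classical
    obtain ⟨m, hm, hmin⟩ : ∃ m, v ∉ D (m + 1) ∧ v ∈ D m := by
      have hpos : Nat.find hex ≠ 0 := fun h0 =>
        Nat.find_spec hex (hDanti (h0 ▸ Nat.zero_le n) hvn)
      obtain ⟨m, hm⟩ := Nat.exists_eq_succ_of_ne_zero hpos
      exact ⟨m, by rw [← Nat.succ_eq_add_one, ← hm]; exact Nat.find_spec hex,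
        not_not.1 (Nat.find_min hex (by omega))⟩
    have hnm : n ≤ m := by
      by_contra! h
      exact hm (hDanti h hvn)
    simp only [hD, mem_ofPred_eq, not_forall] at hm
    obtain ⟨g, hg, hgC⟩ := hm
    rw [pow_succ'] at hg
    obtain ⟨γ, hγ, h, hh, rfl⟩ := hg
    refine ⟨h • v, ⟨γ, hγ, by rwa [mem_compl_iff, ← mul_smul]⟩, ?_⟩
    simp only [mem_iInter]
    intro k hk
    -- Write `h = a * b` with `a ∈ Γ ^ k`, `b ∈ Γ ^ j`: going back by `a⁻¹` reaches `b • v`, which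
    -- `Γ ^ k` keeps in `C` because `v ∈ D (k + j)`.
    obtain ⟨j, rfl⟩ := Nat.exists_eq_add_of_le (hk.trans hnm : k ≤ m)
    rw [pow_add] at hh
    obtain ⟨a, ha, b, hb, rfl⟩ := hh
    refine ⟨a⁻¹, ?_, fun c hc => ?_⟩
    · rw [← hinv, inv_pow]
      exact Set.inv_mem_inv.2 ha
    · rw [← mul_smul a⁻¹, ← mul_smul]
      refine hmin _ ?_
      rw [pow_add]
      exact ⟨c, hc, b, hb, by group⟩
  obtain ⟨u, hu⟩ := IsCompact.nonempty_iInter_of_sequence_nonempty_isCompact_isClosed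
    (fun n : ℕ => B ∩ ⋂ k ∈ Iic n, A k)
    (fun n => inter_subset_inter_right _
      (biInter_subset_biInter_left (Iic_subset_Iic.2 n.le_succ)))
    hexit
    (hBclosed.inter (isClosed_biInter fun k _ => hAclosed k)).isCompact
    (fun n => hBclosed.inter (isClosed_biInter fun k _ => hAclosed k))
  rw [mem_iInter] at hu
  obtain ⟨γ, hγ, hγu⟩ := (hu 0).1
  have huA : ∀ k, u ∈ A k := fun k => mem_iInter₂.1 (hu k).2 k self_mem_Iic
  -- A point of the orbit closure whose whole orbit stays in `C`.
  obtain ⟨t, ht⟩ := IsCompact.nonempty_iInter_of_sequence_nonempty_isCompact_isClosed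
    (fun n : ℕ => closure (MulAction.orbit G u) ∩ D n)
    (fun n => inter_subset_inter_right _ (hDanti n.le_succ))
    (fun n => by
      obtain ⟨g, -, hg⟩ := huA n
      exact ⟨g • u, subset_closure ⟨g, rfl⟩, hg⟩)
    (isClosed_closure.inter (hDclosed 0)).isCompact
    (fun n => isClosed_closure.inter (hDclosed n))
  rw [mem_iInter] at ht
  have htC : ∀ g : G, g • t ∈ C := fun g => by
    obtain ⟨n, hn⟩ := hgen' g
    exact (ht n).2 g hn
  exact hγu (closure_orbit_subset hC.isClosed htC
    (smul_mem_closure_orbit γ (hW u t (ht 0).1)))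

/-- A flow of a compactly generated group on a totally disconnected compact space is equicontinuous
if the orbit closures in its square are minimal. -/
theorem isEquicontinuousFlow_of_totallyDisconnectedSpace {G Z : Type*} [Group G]
    [TopologicalSpace G] [ContinuousMul G] (hG : IsCompactlyGeneratedGroup G) [TopologicalSpace Z]
    [CompactSpace Z] [T2Space Z] [TotallyDisconnectedSpace Z] [MulAction G Z] [ContinuousSMul G Z]
    (hZ : ∀ w v : Z × Z,
      v ∈ closure (MulAction.orbit G w) → w ∈ closure (MulAction.orbit G v)) :
    IsEquicontinuousFlow G Z := by
  let _ : UniformSpace Z := uniformSpaceOfCompactR1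
  change Equicontinuous (fun (g : G) (y : Z) => g • y)
  intro y U hU
  rw [← nhdsSet_diagonal_eq_uniformity, mem_nhdsSet_iff_exists] at hU
  obtain ⟨O, hO, hdO, hOU⟩ := hU
  obtain ⟨C, hC, hdC, hCO⟩ : ∃ C : Set (Z × Z), IsClopen C ∧ diagonal Z ⊆ C ∧ C ⊆ O :=
    exists_clopen_of_closed_subset_open isClosed_diagonal hO hdO
  have h := eventually_forall_smul_mem_of_isClopen hG hZ hC (w := (y, y))
    fun g => hdC (rfl : g • y = g • y)
  have hc : Tendsto (fun z : Z => (y, z)) (𝓝 y) (𝓝 (y, y)) :=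
    (Continuous.prodMk_right y).tendsto y
  filter_upwards [hc.eventually h] with z hz g
  exact hOU (hCO (hz g))

/-! ### The flow on the space of components -/

/-- The action on the space of connected components induced by an action by homeomorphisms. -/
@[reducible]
def ConnectedComponents.mulAction (G X : Type*) [Group G] [TopologicalSpace X] [MulAction G X]
    [ContinuousConstSMul G X] : MulAction G (ConnectedComponents X) where
  smul g := (continuous_const_smul g : Continuous fun x : X => g • x).connectedComponentsMap
  one_smul := ConnectedComponents.surjective_coe.forall.2 fun x =>
    congrArg ConnectedComponents.mk (one_smul G x)
  mul_smul g h := ConnectedComponents.surjective_coe.forall.2 fun x =>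
    congrArg ConnectedComponents.mk (mul_smul g h x)

/-- A factor of a jointly continuous compact flow is jointly continuous. -/
theorem IsFactorMap.continuousSMul {G X Y : Type*} [Group G] [TopologicalSpace G]
    [TopologicalSpace X] [CompactSpace X] [MulAction G X] [ContinuousSMul G X]
    [TopologicalSpace Y] [T2Space Y] [MulAction G Y] {π : X → Y} (hπ : IsFactorMap G π) :
    ContinuousSMul G Y := by
  -- `π` is proper, so its product with the identity is closed even if `G` is not locally compact.
  have hq : IsQuotientMap (Prod.map id π : G × X → G × Y) :=
    (isProperMap_id.prodMap hπ.continuous.isProperMap).isClosedMap.isQuotientMap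
      (continuous_id.prodMap hπ.continuous) (Function.surjective_id.prodMap hπ.surjective)
  refine ⟨hq.continuous_iff.2 ?_⟩
  have : (fun p : G × Y => p.1 • p.2) ∘ Prod.map id π = fun p : G × X => π (p.1 • p.2) :=
    funext fun p => (hπ.map_smul p.1 p.2).symm
  rw [this]
  exact hπ.continuous.comp continuous_smul

theorem ConnectedComponents.nontrivial_of_not_connectedSpace {X : Type*} [TopologicalSpace X]
    [Nonempty X] (hX : ¬ ConnectedSpace X) : Nontrivial (ConnectedComponents X) := by
  by_contra h
  rw [not_nontrivial_iff_subsingleton] at h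
  have : PreconnectedSpace X := preconnectedSpace_iff_connectedComponent.2 fun x =>
    eq_univ_of_forall fun y => ConnectedComponents.coe_eq_coe'.1 (Subsingleton.elim _ _)
  exact hX { toNonempty := inferInstance }

/-- `ConnectedComponents X` is the quotient of `X` by the relation of lying in the same connected
component, with the quotient topology. -/
theorem theorem3p1p2 {G X : Type*}
    [Group G] [TopologicalSpace G] [T2Space G] [ContinuousMul G]
    (hG : IsCompactlyGeneratedGroup G)
    [TopologicalSpace X] [CompactSpace X] [T2Space X] [Nonempty X]
    [MulAction G X] [ContinuousSMul G X]
    (hX : ¬ ConnectedSpace X) (hdistal : IsDistalFlow G X) :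
    CompactSpace (ConnectedComponents X) ∧ T2Space (ConnectedComponents X) ∧
      ∃ _ : MulAction G (ConnectedComponents X),
        ContinuousSMul G (ConnectedComponents X) ∧
        IsFactorMap G (ConnectedComponents.mk : X → ConnectedComponents X) ∧
        Nontrivial (ConnectedComponents X) ∧
        IsEquicontinuousFlow G (ConnectedComponents X) := by
  let _ := ConnectedComponents.mulAction G X
  have hπ : IsFactorMap G (ConnectedComponents.mk : X → ConnectedComponents X) :=
    ⟨ConnectedComponents.continuous_coe, ConnectedComponents.surjective_coe, fun _ _ => rfl⟩
  have hsmul : ContinuousSMul G (ConnectedComponents X) := hπ.continuousSMul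
  refine ⟨inferInstance, inferInstance, inferInstance, hsmul, hπ,
    ConnectedComponents.nontrivial_of_not_connectedSpace hX, ?_⟩
  exact isEquicontinuousFlow_of_totallyDisconnectedSpace hG fun _ _ =>
    (hπ.prodMap hπ).mem_closure_orbit_symm fun _ _ =>
      (hdistal.prod hdistal).mem_closure_orbit_symm
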